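/- **Exponential Separation Theorem, with internal growth control.** Let $X\neq\{0\}$ be a real Banach space and $C\subset X$ a closed convex set with $\lambda C\subset C$ for all $\lambda>0$, $C\cap(-C)=\{0\}$ and nonempty interior $\operatorname{Int}C$. Let $X^*$ be the dual space of $X$ and $C_s^*=\{l\in X^*: l(v)>0 \text{ for all } v\in C\setminus\{0\}\}$. Let $F:E\to E$ be a homeomorphism of a compact metric space $(E,d)$, and let $\{T_x\}_{x\in E}$ be bounded linear operators on $X$, depending continuously on $x$ in the operator norm, such that each $T_x$ is compact and strongly positive, i.e. $T_xv\in\operatorname{Int}C$ for every $v\in C\setminus\{0\}$. Write $T_x^n=T_{F^{n-1}x}\circ\cdots\circ T_{Fx}\circ T_x$ for $n\ge 1$, and let $T_x^*:X^*\to X^*$ be the adjoint of $T_x$. Then there are continuous one-dimensional bundles $\{X_{1x}\}_{x\in E}$ of subspaces of $X$ and $\{X_{1x}^*\}_{x\in E}$ of subspaces of $X^*$ (that is, families locally spanned by continuous nowhere vanishing sections) such that: (i) $X_{1x}=\operatorname{span}\{v_x\}$ and $X_{1x}^*=\operatorname{span}\{l_x\}$, where $\|v_x\|=\|l_x\|=1$,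 $v_x\in\operatorname{Int}C$, $l_x\in C_s^*$, and $v_x$, $l_x$ depend continuously (in norm) on $x\in E$. (ii) $T_xX_{1x}=X_{1,Fx}$ and $T_x^*X_{1,Fx}^*=X_{1x}^*$ for all $x\in E$. (iii) There are constants $M>0$ and $0<\gamma<1$ such that $\|T_x^nw\|\le M\gamma^n\|T_x^nv_x\|$ for all $x\in E$, all $n\ge1$ and all $w\in X$ with $l_x(w)=0$ and $\|w\|=1$. (iv) If $x\in E$ and $u\in X$ satisfy $l_x(u)>0$, then $T_x^nu\in\operatorname{Int}C$ for all sufficiently large $n$. (v) For every $\epsilon>0$ there is $\delta_1>0$ such that for all $\delta\in[0,\delta_1]$, $x,y\in E$ and $m\ge1$ with $d(F^ix,F^iy)<\delta$ for $0\le i\le m$, one has $\|T_y^iv_y\|\le(1+\epsilon)^i\|T_x^iv_x\|$ for all $1\le i\le m$. -/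

import Mathlib

open Set Filter Topology

namespace ExpSep

section Cones

variable {X : Type*} [NormedAddCommGroup X] [NormedSpace ℝ X]

/-- A Banach space `X` with a closed convex cone `C` is strongly ordered if `C ∩ (-C) = {0}` and
`C` has nonempty interior. (`ProperCone ℝ X` is the type of closed convex cones containing `0`.) -/
structure IsStronglyOrdered (C : ProperCone ℝ X) : Prop where
  inter_neg : (C : Set X) ∩ -(C : Set X) = {0}
  nonempty_interior : (interior (C : Set X)).Nonempty

/-- `C_s^*`: the bounded functionals that are positive on `C \ {0}`. Such a functional is
nonnegative on `C`, so it lies in the dual cone. -/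
def strictDualCone (C : ProperCone ℝ X) : Set (StrongDual ℝ X) :=
  {l | ∀ v ∈ C, v ≠ 0 → 0 < l v}

/-- `L` is strongly positive: `L v ≫ 0` whenever `v > 0`. -/
def StronglyPositive (C : ProperCone ℝ X) (L : X →L[ℝ] X) : Prop :=
  ∀ v ∈ C, v ≠ 0 → L v ∈ interior (C : Set X)

end Cones

section Bundles

variable {E X : Type*} [TopologicalSpace E] [NormedAddCommGroup X] [NormedSpace ℝ X]

/-- A family of subspaces of `X` indexed by `E` is a continuous one-dimensional bundle if it is
locally spanned by a continuous nowhere vanishing section. -/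
def IsContinuousLineBundle (V : E → Submodule ℝ X) : Prop :=
  ∀ x₀ : E, ∃ U ∈ 𝓝 x₀, ∃ s : E → X, ContinuousOn s U ∧
    ∀ x ∈ U, s x ≠ 0 ∧ V x = Submodule.span ℝ {s x}

/-- The cocycle `T_x^n = T_{F^{n-1} x} ∘ ⋯ ∘ T_{F x} ∘ T_x`, with `T_x^0` the identity. -/
def cocycle (F : E → E) (T : E → X →L[ℝ] X) : ℕ → E → X →L[ℝ] X
  | 0, _ => ContinuousLinearMap.id ℝ X
  | n + 1, x => (T (F^[n] x)).comp (cocycle F T n x)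

/-- The adjoint `L^* : X^* → X^*`, `l ↦ l ∘ L`, of a bounded operator `L`. -/
noncomputable def adjointOp (L : X →L[ℝ] X) : StrongDual ℝ X →L[ℝ] StrongDual ℝ X :=
  ContinuousLinearMap.precomp ℝ L

end Bundles

end ExpSep

/-!
The compactness of the operators `T x` enters through one *focusing* estimate (`exists_focusing`):
if `u ≥ 0` and `‖T x u‖ ≥ δ ‖u‖`, then `T y (T x u) ≥ κ ‖u‖ e` with `κ = κ(δ) > 0`, where `e` is an
interior point of the cone. The cone need not be normal, so order bounds do not bound norms;
instead, for a positive functional `φ` and an orbit `u` in the cone, focusing gives the recursion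
(`exists_norm_recursion`) `φ e * ‖T x u‖ ≤ δ * φ e * ‖u‖ + A * φ (T y (T x u))`. With pullbacks of
one positive functional taken along the orbit, its last term does not change, and `δ` can be taken
smaller than the rate at which `φ e` may vary; so norms along the orbit are controlled by
functionals. By Farkas' lemma the orbit of `e` therefore stays uniformly inside the cone
(`exists_cocycle_sub_smul_mem`).

Let `w` be the orbit of `e`, and let `f` be an orbit annihilated by a positive functional at a later
time. If `-μ w ≤ f ≤ μ w`, the recursion applied to `μ w + f ≥ 0` bounds the norm of `f` by `μ ‖w‖`,
and focusing applied to `μ w + f` and `μ w - f` shrinks `μ` by a fixed factor in two steps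
(`exists_norm_apply_le`, `exists_order_contraction`). This is exponential decay of `f` relative to
`w` (`exists_norm_cocycle_le_of_apply_eq_zero`).

It follows that the functionals `φ ∘ T_x^n / φ (T_x^n e)` are Cauchy in norm, uniformly in `x`.
Their limits `l x` are continuous in `x`, strictly positive and invariant under the adjoints, and
the orbits starting in `ker (l x)` decay relative to that of `e` (`exists_isInvariantFunctional`).
The images of `e` under `T_y^n` with `F^n y = x`, normalised by `l x`, then converge uniformly to
the invariant vectors `v x` (`exists_invariant_vector`). Eventual positivity follows from the
splitting `u = l x u • v x + f` with `f ∈ ker (l x)`, and growth along the sections is a product of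
values of a positive continuous function on `E` (`exists_growth_control`).
-/

namespace ExpSep

/-! ### Order units and positive functionals -/

section OrderUnits

variable {X : Type*} [NormedAddCommGroup X] [NormedSpace ℝ X] {C : ProperCone ℝ X} {e : X}

/-- `e` is an order unit of `C` normalised by the norm: `-‖u‖ e ≤ u ≤ ‖u‖ e` for every `u`, in the
order given by `C`. Equivalently, `C` contains the closed unit ball centred at `e`. -/
def IsNormOrderUnit (C : ProperCone ℝ X) (e : X) : Prop :=
  ∀ u : X, ‖u‖ • e + u ∈ C

/-- `φ` is nonnegative on `C`, that is, `φ` belongs to the dual cone. -/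
def IsPositiveFunctional (C : ProperCone ℝ X) (φ : StrongDual ℝ X) : Prop :=
  ∀ v ∈ C, 0 ≤ φ v

lemma IsStronglyOrdered.eq_zero (hC : IsStronglyOrdered C) {v : X} (hv : v ∈ C) (hv' : -v ∈ C) :
    v = 0 := by
  have h : v ∈ (C : Set X) ∩ -(C : Set X) := ⟨hv, hv'⟩
  rw [hC.inter_neg] at h
  exact h

lemma IsStronglyOrdered.exists_isNormOrderUnit (hC : IsStronglyOrdered C) :
    ∃ e : X, IsNormOrderUnit C e := by
  obtain ⟨e, he⟩ := hC.nonempty_interior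
  obtain ⟨r, hr, hball⟩ := Metric.nhds_basis_closedBall.mem_iff.1 (mem_interior_iff_mem_nhds.1 he)
  refine ⟨r⁻¹ • e, fun u => ?_⟩
  rcases eq_or_ne u 0 with rfl | hu
  · simp
  have hu' : 0 < ‖u‖ := norm_pos_iff.2 hu
  have h1 : e + (r / ‖u‖) • u ∈ C := hball (by
    rw [Metric.mem_closedBall, dist_eq_norm, add_sub_cancel_left, norm_smul, Real.norm_eq_abs,
      abs_of_pos (by positivity), div_mul_cancel₀ _ hu'.ne'])
  have h2 := C.smul_mem h1 (show 0 ≤ ‖u‖ * r⁻¹ by positivity)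
  convert h2 using 1
  rw [smul_add, smul_smul, smul_smul]
  congr 1
  rw [show ‖u‖ * r⁻¹ * (r / ‖u‖) = 1 by field_simp, one_smul]

namespace IsNormOrderUnit

lemma smul_sub_mem (he : IsNormOrderUnit C e) (u : X) : ‖u‖ • e - u ∈ C := by
  simpa [sub_eq_add_neg] using he (-u)

lemma ne_zero [Nontrivial X] (hC : IsStronglyOrdered C) (he : IsNormOrderUnit C e) : e ≠ 0 := by
  rintro rfl
  obtain ⟨u, hu⟩ := exists_ne (0 : X)
  exact hu (hC.eq_zero (by simpa using he u) (by simpa using he (-u)))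

lemma mem [Nontrivial X] (hC : IsStronglyOrdered C) (he : IsNormOrderUnit C e) : e ∈ C := by
  have h0 : 0 < ‖e‖ := norm_pos_iff.2 (he.ne_zero hC)
  have h := C.smul_mem (he e) (show 0 ≤ (‖e‖ + 1)⁻¹ by positivity)
  rwa [show ‖e‖ • e + e = (‖e‖ + 1) • e by rw [add_smul, one_smul], smul_smul,
    inv_mul_cancel₀ (by positivity), one_smul] at h

lemma mem_interior [Nontrivial X] (hC : IsStronglyOrdered C) (he : IsNormOrderUnit C e) {u : X}
    {c : ℝ} (hc : 0 < c) (h : u - c • e ∈ C) : u ∈ interior (C : Set X) := by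
  rw [mem_interior_iff_mem_nhds]
  refine Metric.nhds_basis_closedBall.mem_iff.2 ⟨c, hc, fun w hw => ?_⟩
  rw [Metric.mem_closedBall, dist_eq_norm] at hw
  have h1 := C.add_mem (C.add_mem h (he (w - u))) (C.smul_mem (he.mem hC) (sub_nonneg.2 hw))
  rw [show w = u - c • e + (‖w - u‖ • e + (w - u)) + (c - ‖w - u‖) • e by module]
  exact h1

/-- A compact subset of the interior of the cone dominates a common positive multiple of `e`. -/
lemma exists_sub_smul_mem_of_isCompact {S : Set X} (hS : IsCompact S)
    (hSC : S ⊆ interior (C : Set X)) (e : X) : ∃ κ > (0 : ℝ), ∀ s ∈ S, s - κ • e ∈ C := by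
  obtain ⟨δ, hδ, hsub⟩ := hS.exists_cthickening_subset_open isOpen_interior hSC
  refine ⟨δ / (‖e‖ + 1), by positivity, fun s hs => interior_subset (hsub ?_)⟩
  refine Metric.mem_cthickening_of_dist_le _ s _ _ hs ?_
  rw [dist_eq_norm, sub_sub_cancel_left, norm_neg, norm_smul, Real.norm_eq_abs,
    abs_of_pos (by positivity), div_mul_eq_mul_div, div_le_iff₀ (by positivity)]
  nlinarith [norm_nonneg e]

lemma abs_apply_le (he : IsNormOrderUnit C e) {φ : StrongDual ℝ X}
    (hφ : IsPositiveFunctional C φ) (u : X) : |φ u| ≤ ‖u‖ * φ e := by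
  have h1 := hφ _ (he u)
  have h2 := hφ _ (he.smul_sub_mem u)
  simp only [map_add, map_sub, map_smul, smul_eq_mul] at h1 h2
  exact abs_le.2 ⟨by linarith, by linarith⟩

lemma apply_le (he : IsNormOrderUnit C e) {φ : StrongDual ℝ X}
    (hφ : IsPositiveFunctional C φ) (u : X) : φ u ≤ ‖u‖ * φ e :=
  (le_abs_self _).trans (he.abs_apply_le hφ u)

/-- Farkas: the cone is cut out by its positive functionals, normalised at `e`. -/
lemma mem_of_forall_apply_nonneg (he : IsNormOrderUnit C e) {u : X}
    (h : ∀ φ : StrongDual ℝ X, IsPositiveFunctional C φ → φ e = 1 → 0 ≤ φ u) : u ∈ C := by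
  by_contra hu
  obtain ⟨f, hf, hfu⟩ := C.hyperplane_separation_point hu
  have hpos : 0 < f e := by
    have := he.abs_apply_le hf u
    by_contra hle
    have : |f u| ≤ 0 := this.trans (mul_nonpos_of_nonneg_of_nonpos (norm_nonneg _) (not_lt.1 hle))
    exact hfu.ne (abs_nonpos_iff.1 this)
  have h1 := h ((f e)⁻¹ • f) (fun v hv => by
    simpa using mul_nonneg (inv_nonneg.2 hpos.le) (hf v hv)) (by simp [hpos.ne'])
  have h2 : (f e)⁻¹ * f u < 0 := mul_neg_of_pos_of_neg (inv_pos.2 hpos) hfu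
  simp only [smul_apply, smul_eq_mul] at h1
  linarith

lemma exists_positiveFunctional [Nontrivial X] (hC : IsStronglyOrdered C)
    (he : IsNormOrderUnit C e) :
    ∃ φ : StrongDual ℝ X, IsPositiveFunctional C φ ∧ φ e = 1 := by
  by_contra! hne
  have : -e ∈ C := he.mem_of_forall_apply_nonneg fun φ hφ h1 => absurd h1 (hne φ hφ)
  exact he.ne_zero hC (hC.eq_zero (he.mem hC) this)

lemma le_norm_of_sub_smul_mem [Nontrivial X] (hC : IsStronglyOrdered C) (he : IsNormOrderUnit C e)
    {u : X} {c : ℝ} (h : u - c • e ∈ C) : c ≤ ‖u‖ := by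
  obtain ⟨φ, hφ, h1⟩ := he.exists_positiveFunctional hC
  have h2 := hφ _ h
  have h3 := he.apply_le hφ u
  simp only [map_sub, map_smul, smul_eq_mul, h1] at h2 h3
  linarith

end IsNormOrderUnit

lemma IsPositiveFunctional.comp {φ : StrongDual ℝ X} (hφ : IsPositiveFunctional C φ)
    {L : X →L[ℝ] X} (hL : ∀ v ∈ C, L v ∈ C) : IsPositiveFunctional C (φ.comp L) :=
  fun v hv => hφ _ (hL v hv)

lemma StronglyPositive.map_mem {L : X →L[ℝ] X} (hL : StronglyPositive C L) {v : X} (hv : v ∈ C) :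
    L v ∈ C := by
  rcases eq_or_ne v 0 with rfl | h0
  · simp
  · exact interior_subset (hL v hv h0)

end OrderUnits

/-! ### Collective compactness and focusing -/

section Focusing

variable {X : Type*} [NormedAddCommGroup X] [NormedSpace ℝ X] {C : ProperCone ℝ X} {e : X}
variable {E : Type*} [TopologicalSpace E] [CompactSpace E] {T : E → X →L[ℝ] X}

lemma exists_norm_le_of_continuous (hT : Continuous T) : ∃ B : ℝ, 1 ≤ B ∧ ∀ x, ‖T x‖ ≤ B := by
  obtain ⟨B, hB⟩ := isCompact_univ.exists_bound_of_continuousOn hT.continuousOn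
  exact ⟨max B 1, le_max_right _ _, fun x => (hB x (mem_univ x)).trans (le_max_left _ _)⟩

/-- A norm-continuous family of compact operators over a compact space is collectively compact. -/
lemma isCompact_closure_iUnion_image [CompleteSpace X] (hT : Continuous T)
    (hTc : ∀ x, IsCompactOperator (T x)) :
    IsCompact (closure (⋃ x, T x '' Metric.closedBall 0 1)) := by
  refine TotallyBounded.isCompact_of_isClosed (TotallyBounded.closure ?_) isClosed_closure
  rw [Metric.totallyBounded_iff]
  intro ε hε
  -- finitely many operators are `ε / 2`-dense in the family
  obtain ⟨s, hsub, hs, hcov⟩ := (isCompact_range hT).finite_cover_balls (half_pos hε)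
  have hK : IsCompact (⋃ L ∈ s, closure (L '' Metric.closedBall 0 1)) := by
    refine hs.isCompact_biUnion fun L hL => ?_
    obtain ⟨x, rfl⟩ := hsub hL
    exact (hTc x).isCompact_closure_image_closedBall (f := (T x : X →ₗ[ℝ] X)) 1
  obtain ⟨t, -, ht, hcov'⟩ := hK.finite_cover_balls (half_pos hε)
  refine ⟨t, ht, iUnion_subset fun x => ?_⟩
  rintro _ ⟨u, hu, rfl⟩
  obtain ⟨L, hL, hxL⟩ := mem_iUnion₂.1 (hcov (mem_range_self x))
  obtain ⟨y, hy, hyL⟩ := mem_iUnion₂.1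
    (hcov' (mem_iUnion₂.2 ⟨L, hL, subset_closure (mem_image_of_mem L hu)⟩))
  refine mem_iUnion₂.2 ⟨y, hy, ?_⟩
  rw [Metric.mem_ball, dist_eq_norm] at *
  rw [mem_closedBall_zero_iff] at hu
  have h1 : ‖T x u - L u‖ ≤ ‖T x - L‖ * 1 := (T x - L).le_opNorm_of_le hu
  calc ‖T x u - y‖ ≤ ‖T x u - L u‖ + ‖L u - y‖ := norm_sub_le_norm_sub_add_norm_sub _ _ _
    _ < ε := by linarith

/-- If `T x` does not shrink `u ≥ 0` too much, then `T y (T x u)` lies uniformly inside the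
cone. -/
lemma exists_focusing [CompleteSpace X] (hT : Continuous T) (hTc : ∀ x, IsCompactOperator (T x))
    (hTpos : ∀ x, StronglyPositive C (T x)) (e : X) {δ : ℝ} (hδ : 0 < δ) :
    ∃ κ > (0 : ℝ), ∀ (x y : E), ∀ u ∈ C, δ * ‖u‖ ≤ ‖T x u‖ → T y (T x u) - (κ * ‖u‖) • e ∈ C := by
  set Z : Set X := closure (⋃ x, T x '' Metric.closedBall 0 1) ∩ (C ∩ {z | δ ≤ ‖z‖}) with hZ
  have hZc : IsCompact Z := (isCompact_closure_iUnion_image hT hTc).inter_right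
    (C.isClosed.inter (isClosed_le continuous_const continuous_norm))
  have hSc : IsCompact ((fun p : E × X => T p.1 p.2) '' (univ ×ˢ Z)) :=
    (isCompact_univ.prod hZc).image (by fun_prop)
  obtain ⟨κ, hκ, h⟩ := IsNormOrderUnit.exists_sub_smul_mem_of_isCompact (C := C) hSc (by
    rintro _ ⟨⟨y, z⟩, ⟨-, -, hzC, hz⟩, rfl⟩
    exact hTpos y z hzC (norm_pos_iff.1 (hδ.trans_le hz))) e
  refine ⟨κ, hκ, fun x y u hu hxu => ?_⟩
  rcases eq_or_ne u 0 with rfl | hu0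
  · simp
  have hn : 0 < ‖u‖ := norm_pos_iff.2 hu0
  have hz : T x (‖u‖⁻¹ • u) ∈ Z := by
    refine ⟨subset_closure (mem_iUnion.2 ⟨x, _, ?_, rfl⟩),
      (hTpos x).map_mem (C.smul_mem hu (inv_nonneg.2 hn.le)), ?_⟩
    · simp [norm_smul, hn.ne']
    · simp only [map_smul, norm_smul, norm_inv, norm_norm, mem_ofPred_eq]
      rw [inv_mul_eq_div, le_div_iff₀ hn]
      exact hxu
  have h1 := C.smul_mem (h _ ⟨(y, _), ⟨mem_univ _, hz⟩, rfl⟩) hn.le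
  convert h1 using 1
  simp only [map_smul, smul_sub, smul_smul, mul_inv_cancel₀ hn.ne', one_smul,
    mul_comm κ]

lemma exists_apply_sub_smul_mem (hT : Continuous T) (hTpos : ∀ x, StronglyPositive C (T x))
    (he : e ∈ C) (h0 : e ≠ 0) : ∃ κ > (0 : ℝ), ∀ x, T x e - κ • e ∈ C := by
  obtain ⟨κ, hκ, h⟩ := IsNormOrderUnit.exists_sub_smul_mem_of_isCompact (C := C)
    (isCompact_range (f := fun x => T x e) (by fun_prop))
    (by rintro _ ⟨x, rfl⟩; exact hTpos x e he h0) e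
  exact ⟨κ, hκ, fun x => h _ ⟨x, rfl⟩⟩

end Focusing

/-! ### The cocycle and the orbit of the order unit -/

section Cocycle

variable {X : Type*} [NormedAddCommGroup X] [NormedSpace ℝ X] {C : ProperCone ℝ X}
variable {E : Type*} {F : E → E} {T : E → X →L[ℝ] X}

@[simp] lemma cocycle_zero_apply (x : E) (u : X) : cocycle F T 0 x u = u := rfl

lemma cocycle_succ_apply (n : ℕ) (x : E) (u : X) :
    cocycle F T (n + 1) x u = T (F^[n] x) (cocycle F T n x u) := rfl

lemma cocycle_succ_apply' (n : ℕ) (x : E) (u : X) :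
    cocycle F T (n + 1) x u = cocycle F T n (F x) (T x u) := by
  induction n with
  | zero => rfl
  | succ n ih => rw [cocycle_succ_apply, ih, cocycle_succ_apply, Function.iterate_succ_apply]

lemma cocycle_mem (hTpos : ∀ x, StronglyPositive C (T x)) (n : ℕ) (x : E) {u : X} (hu : u ∈ C) :
    cocycle F T n x u ∈ C := by
  induction n with
  | zero => exact hu
  | succ n ih => exact (hTpos _).map_mem ih

end Cocycle

section Orbit

variable {X : Type*} [NormedAddCommGroup X] [NormedSpace ℝ X] {C : ProperCone ℝ X} {e : X}
variable {E : Type*} [TopologicalSpace E] [CompactSpace E] {T : E → X →L[ℝ] X}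

/-- Along an orbit in the cone the norm is controlled by any positive functional evaluated two
steps after: if it were not decreasing geometrically, focusing would push the orbit inside the
cone, where the functional is comparable to the norm. -/
lemma exists_norm_recursion [CompleteSpace X] [Nontrivial X] (hC : IsStronglyOrdered C)
    (he : IsNormOrderUnit C e) (hT : Continuous T) (hTc : ∀ x, IsCompactOperator (T x))
    (hTpos : ∀ x, StronglyPositive C (T x)) {δ : ℝ} (hδ : 0 < δ) :
    ∃ A > (0 : ℝ), ∀ (x y : E) (φ : StrongDual ℝ X), IsPositiveFunctional C φ → ∀ u ∈ C,
      φ e * ‖T x u‖ ≤ δ * (φ e * ‖u‖) + A * φ (T y (T x u)) := by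
  obtain ⟨κ, hκ, hfoc⟩ := exists_focusing hT hTc hTpos e hδ
  obtain ⟨B, hB1, hB⟩ := exists_norm_le_of_continuous hT
  refine ⟨B / κ, by positivity, fun x y φ hφ u hu => ?_⟩
  have hφe : 0 ≤ φ e := hφ e (he.mem hC)
  have h0 : 0 ≤ φ (T y (T x u)) := hφ _ ((hTpos y).map_mem ((hTpos x).map_mem hu))
  rcases le_total (δ * ‖u‖) (‖T x u‖) with h | h
  · have h1 := hφ _ (hfoc x y u hu h)
    simp only [map_sub, map_smul, smul_eq_mul] at h1
    have h2 : ‖T x u‖ ≤ B * ‖u‖ := (T x).le_of_opNorm_le (hB x) u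
    have h3 : φ e * ‖T x u‖ ≤ B / κ * φ (T y (T x u)) := by
      calc φ e * ‖T x u‖ ≤ φ e * (B * ‖u‖) := by gcongr
        _ = B / κ * (κ * ‖u‖ * φ e) := by field_simp
        _ ≤ B / κ * φ (T y (T x u)) := by gcongr; linarith
    have : 0 ≤ δ * (φ e * ‖u‖) := by positivity
    linarith
  · have : φ e * ‖T x u‖ ≤ φ e * (δ * ‖u‖) := by gcongr
    have : 0 ≤ B / κ * φ (T y (T x u)) := by positivity
    linarith

lemma exists_apply_cocycle_lower_bound [CompleteSpace X] [Nontrivial X] (hC : IsStronglyOrdered C)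
    (he : IsNormOrderUnit C e) (hT : Continuous T) (hTc : ∀ x, IsCompactOperator (T x))
    (hTpos : ∀ x, StronglyPositive C (T x)) (F : E → E) :
    ∃ R > (0 : ℝ), ∀ (n : ℕ) (x : E) (φ : StrongDual ℝ X), IsPositiveFunctional C φ →
      φ e * ‖cocycle F T n x e‖ ≤ R * φ (cocycle F T (n + 1) x e) := by
  have heC := he.mem hC
  obtain ⟨κ, hκ, hlow⟩ := exists_apply_sub_smul_mem hT hTpos heC (he.ne_zero hC)
  obtain ⟨A, hA, hrec⟩ := exists_norm_recursion hC he hT hTc hTpos (half_pos hκ)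
  have hφlow : ∀ (φ : StrongDual ℝ X), IsPositiveFunctional C φ → ∀ x, κ * φ e ≤ φ (T x e) := by
    intro φ hφ x
    have := hφ _ (hlow x)
    simp only [map_sub, map_smul, smul_eq_mul] at this
    linarith
  refine ⟨max (‖e‖ / κ) (2 * A), by positivity, fun n => ?_⟩
  set R := max (‖e‖ / κ) (2 * A)
  induction n with
  | zero =>
    intro x φ hφ
    have h0 : 0 ≤ φ (T x e) := hφ _ ((hTpos x).map_mem heC)
    calc φ e * ‖e‖ = ‖e‖ / κ * (κ * φ e) := by field_simp
      _ ≤ ‖e‖ / κ * φ (T x e) := by gcongr; exact hφlow φ hφ x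
      _ ≤ R * φ (T x e) := by gcongr; exact le_max_left _ _
  | succ n ih =>
    intro x φ hφ
    -- the inductive hypothesis is used for the pullback of `φ` by the last operator
    have h1 := ih x (φ.comp (T (F^[n + 1] x))) (hφ.comp fun v hv => (hTpos _).map_mem hv)
    have h2 := hrec (F^[n] x) (F^[n + 1] x) φ hφ _ (cocycle_mem (F := F) hTpos n x heC)
    have h3 := hφlow φ hφ (F^[n + 1] x)
    have h0 : 0 ≤ φ (cocycle F T (n + 1 + 1) x e) := hφ _ (cocycle_mem hTpos _ x heC)
    simp only [ContinuousLinearMap.comp_apply, ← cocycle_succ_apply] at h1 h2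
    have h4 : κ * φ e * ‖cocycle F T n x e‖ ≤ R * φ (cocycle F T (n + 1 + 1) x e) :=
      (mul_le_mul_of_nonneg_right h3 (norm_nonneg _)).trans h1
    have h5 : 2 * A * φ (cocycle F T (n + 1 + 1) x e) ≤ R * φ (cocycle F T (n + 1 + 1) x e) :=
      mul_le_mul_of_nonneg_right (le_max_right _ _) h0
    linarith

/-- The orbit of the order unit stays uniformly inside the cone. -/
lemma exists_cocycle_sub_smul_mem [CompleteSpace X] [Nontrivial X] (hC : IsStronglyOrdered C)
    (he : IsNormOrderUnit C e) (hT : Continuous T) (hTc : ∀ x, IsCompactOperator (T x))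
    (hTpos : ∀ x, StronglyPositive C (T x)) (F : E → E) :
    ∃ κ > (0 : ℝ), ∀ (n : ℕ) (x : E),
      cocycle F T n x e - (κ * ‖cocycle F T n x e‖) • e ∈ C := by
  have hn : 0 < ‖e‖ := norm_pos_iff.2 (he.ne_zero hC)
  obtain ⟨R, hR, h⟩ := exists_apply_cocycle_lower_bound hC he hT hTc hTpos F
  obtain ⟨B, hB1, hB⟩ := exists_norm_le_of_continuous hT
  refine ⟨min ‖e‖⁻¹ (R * B)⁻¹, by positivity, fun n x => he.mem_of_forall_apply_nonneg ?_⟩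
  intro φ hφ h1
  simp only [map_sub, map_smul, smul_eq_mul, h1, mul_one, sub_nonneg]
  cases n with
  | zero =>
    calc min ‖e‖⁻¹ (R * B)⁻¹ * ‖e‖ ≤ ‖e‖⁻¹ * ‖e‖ := by gcongr; exact min_le_left _ _
      _ = φ e := by rw [h1, inv_mul_cancel₀ hn.ne']
  | succ n =>
    have h2 : ‖cocycle F T (n + 1) x e‖ ≤ B * ‖cocycle F T n x e‖ :=
      (T _).le_of_opNorm_le (hB _) _
    have h3 := h n x φ hφ
    rw [h1, one_mul] at h3
    calc min ‖e‖⁻¹ (R * B)⁻¹ * ‖cocycle F T (n + 1) x e‖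
        ≤ (R * B)⁻¹ * (B * (R * φ (cocycle F T (n + 1) x e))) := by
          gcongr
          · exact min_le_right _ _
          · exact h2.trans (by gcongr)
      _ = φ (cocycle F T (n + 1) x e) := by field_simp

end Orbit

/-! ### Contraction transversally to the orbit of the order unit -/

section Contraction

variable {X : Type*} [NormedAddCommGroup X] [NormedSpace ℝ X] {C : ProperCone ℝ X} {e : X}
variable {E : Type*} [TopologicalSpace E] [CompactSpace E] {T : E → X →L[ℝ] X}

lemma exists_norm_le_mul_norm_apply [Nontrivial X] (hC : IsStronglyOrdered C)
    (he : IsNormOrderUnit C e) (hT : Continuous T) (hTpos : ∀ x, StronglyPositive C (T x))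
    {κ : ℝ} (hκ : 0 < κ) :
    ∃ K > (0 : ℝ), ∀ (x : E) (w : X), w - (κ * ‖w‖) • e ∈ C → ‖w‖ ≤ K * ‖T x w‖ := by
  obtain ⟨κ₀, hκ₀, hlow⟩ := exists_apply_sub_smul_mem hT hTpos (he.mem hC) (he.ne_zero hC)
  refine ⟨(κ * κ₀)⁻¹, by positivity, fun x w hw => ?_⟩
  have h1 := C.add_mem ((hTpos x).map_mem hw)
    (C.smul_mem (hlow x) (show 0 ≤ κ * ‖w‖ by positivity))
  have h2 : κ * ‖w‖ * κ₀ ≤ ‖T x w‖ := by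
    refine he.le_norm_of_sub_smul_mem hC ?_
    have h2 : T x w - (κ * ‖w‖ * κ₀) • e
        = T x (w - (κ * ‖w‖) • e) + (κ * ‖w‖) • (T x e - κ₀ • e) := by
      rw [map_sub, map_smul]
      module
    rw [h2]
    exact h1
  rw [inv_mul_eq_div, le_div_iff₀ (by positivity)]
  linarith

/-- One step of the norm estimate: if `-μ w ≤ f` and the image of `f` after two steps is annihilated
by a positive functional, then a bound `‖f‖ ≤ L μ ‖w‖` improves by a factor `1 / 2` in one step. The
spare factor pays for the later contraction of `μ`. -/
lemma exists_norm_apply_le [CompleteSpace X] [Nontrivial X] (hC : IsStronglyOrdered C)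
    (he : IsNormOrderUnit C e) (hT : Continuous T) (hTc : ∀ x, IsCompactOperator (T x))
    (hTpos : ∀ x, StronglyPositive C (T x)) {κ : ℝ} (hκ : 0 < κ) :
    ∃ L ≥ (1 : ℝ), ∀ (x y : E) (φ : StrongDual ℝ X), IsPositiveFunctional C φ → 0 < φ e →
      ∀ (w f : X) (μ : ℝ), 0 ≤ μ → w - (κ * ‖w‖) • e ∈ C → μ • w + f ∈ C →
        φ (T y (T x f)) = 0 → ‖f‖ ≤ L * (μ * ‖w‖) → ‖T x f‖ ≤ L / 2 * (μ * ‖T x w‖) := by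
  obtain ⟨K, hK, hKw⟩ := exists_norm_le_mul_norm_apply hC he hT hTpos hκ
  obtain ⟨A, hA, hrec⟩ := exists_norm_recursion hC he hT hTc hTpos
    (show 0 < (4 * K)⁻¹ by positivity)
  obtain ⟨B, hB1, hB⟩ := exists_norm_le_of_continuous hT
  have hAB : 0 < A * B := by positivity
  refine ⟨4 * (A * B + 1) + 1, by linarith, fun x y φ hφ hφe w f μ hμ hw hwf hφf hf => ?_⟩
  have h1 := hrec x y φ hφ _ hwf
  have h2 : φ (T y (T x (μ • w + f))) ≤ φ e * (B * (μ * ‖T x w‖)) := by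
    simp only [map_add, map_smul, smul_eq_mul, hφf, add_zero]
    have h3 : φ (T y (T x w)) ≤ B * ‖T x w‖ * φ e :=
      (he.apply_le hφ _).trans (by gcongr; exact (T y).le_of_opNorm_le (hB y) _)
    nlinarith
  have h3 : ‖T x (μ • w + f)‖ ≤ (4 * K)⁻¹ * ‖μ • w + f‖ + A * (B * (μ * ‖T x w‖)) := by
    refine le_of_mul_le_mul_left (h1.trans ?_) hφe
    have := mul_le_mul_of_nonneg_left h2 hA.le
    linarith
  have hnw : ‖μ • w‖ = μ * ‖w‖ := by rw [norm_smul, Real.norm_of_nonneg hμ]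
  have h4 : ‖μ • w + f‖ ≤ (4 * (A * B + 1) + 2) * (K * (μ * ‖T x w‖)) := by
    have h5 : μ * ‖w‖ ≤ K * (μ * ‖T x w‖) := by
      have := mul_le_mul_of_nonneg_left (hKw x w hw) hμ
      linarith
    calc ‖μ • w + f‖ ≤ ‖μ • w‖ + ‖f‖ := norm_add_le _ _
      _ ≤ (4 * (A * B + 1) + 2) * (μ * ‖w‖) := by rw [hnw]; linarith
      _ ≤ _ := by gcongr
  have h5 : (4 * K)⁻¹ * ‖μ • w + f‖ ≤ (A * B + 1 + 1 / 2) * (μ * ‖T x w‖) := by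
    calc (4 * K)⁻¹ * ‖μ • w + f‖
        ≤ (4 * K)⁻¹ * ((4 * (A * B + 1) + 2) * (K * (μ * ‖T x w‖))) := by gcongr
      _ = _ := by field_simp; ring
  have h6 : ‖T x f‖ ≤ ‖T x (μ • w + f)‖ + μ * ‖T x w‖ := by
    have : T x f = T x (μ • w + f) - μ • T x w := by simp
    rw [this]
    refine (norm_sub_le _ _).trans_eq ?_
    rw [norm_smul, Real.norm_of_nonneg hμ]
  have h7 : 0 ≤ μ * ‖T x w‖ := by positivity
  nlinarith

/-- Contraction of the order bound in two steps. Since `φ` annihilates the image of `f`, the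
vector `μ w + f ≥ 0` has an image of norm at least a multiple of `μ ‖w‖`; after one more step,
focusing puts it above a multiple of `μ w`. -/
lemma exists_order_contraction [CompleteSpace X] [Nontrivial X] (hC : IsStronglyOrdered C)
    (he : IsNormOrderUnit C e) (hT : Continuous T) (hTc : ∀ x, IsCompactOperator (T x))
    (hTpos : ∀ x, StronglyPositive C (T x)) {κ L : ℝ} (hκ : 0 < κ) (hL : 1 ≤ L) :
    ∃ θ : ℝ, 1 / 2 ≤ θ ∧ θ < 1 ∧ ∀ (x y : E) (φ : StrongDual ℝ X), IsPositiveFunctional C φ →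
      0 < φ e → ∀ (w f : X) (μ : ℝ), 0 ≤ μ → w - (κ * ‖w‖) • e ∈ C →
        T x w - (κ * ‖T x w‖) • e ∈ C → μ • w + f ∈ C → φ (T x f) = 0 →
        ‖f‖ ≤ L * (μ * ‖w‖) → (θ * μ) • T y (T x w) + T y (T x f) ∈ C := by
  obtain ⟨K, hK, hKw⟩ := exists_norm_le_mul_norm_apply hC he hT hTpos hκ
  obtain ⟨B, hB1, hB⟩ := exists_norm_le_of_continuous hT
  have hB0 : 0 < B := by linarith
  set a := κ / K with ha
  have ha0 : 0 < a := by positivity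
  obtain ⟨κ', hκ', hfoc⟩ := exists_focusing hT hTc hTpos e
    (show 0 < a / (L + 1) by positivity)
  set η := min (1 / 2) (κ' * a / B ^ 3) with hη
  have hη0 : 0 < η := by positivity
  refine ⟨1 - η, by linarith [min_le_left (1 / 2) (κ' * a / B ^ 3)], by linarith, ?_⟩
  intro x y φ hφ hφe w f μ hμ hw hTw hwf hφf hf
  set u := μ • w + f with hu
  have hwn := hKw x w hw
  have h1 : a * (μ * ‖w‖) ≤ ‖T x u‖ := by
    have h2 := hφ _ hTw
    have h3 := he.apply_le hφ (T x u)
    simp only [hu, map_add, map_sub, map_smul, smul_eq_mul, hφf, add_zero] at h2 h3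
    have h4 : μ * (κ * ‖T x w‖) ≤ ‖T x u‖ := by
      refine le_of_mul_le_mul_right ?_ hφe
      rw [hu, map_add, map_smul]
      nlinarith
    refine le_trans ?_ h4
    calc a * (μ * ‖w‖) ≤ a * (μ * (K * ‖T x w‖)) := by gcongr
      _ = μ * (κ * ‖T x w‖) := by rw [ha]; field_simp
  have h2 : ‖u‖ ≤ (L + 1) * (μ * ‖w‖) := by
    calc ‖u‖ ≤ ‖μ • w‖ + ‖f‖ := norm_add_le _ _
      _ ≤ (L + 1) * (μ * ‖w‖) := by rw [norm_smul, Real.norm_of_nonneg hμ]; linarith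
  have h3 : a / (L + 1) * ‖u‖ ≤ ‖T x u‖ := by
    refine le_trans ?_ h1
    calc a / (L + 1) * ‖u‖ ≤ a / (L + 1) * ((L + 1) * (μ * ‖w‖)) := by gcongr
      _ = a * (μ * ‖w‖) := by field_simp
  have h4 := hfoc x y u hwf h3
  -- `T y (T x u)` dominates `κ' ‖u‖ e`, and `η μ T y (T x w)` is below that
  have h5 : ‖T y (T x w)‖ ≤ B * (B * ‖w‖) :=
    ((T y).le_of_opNorm_le (hB y) _).trans (by gcongr; exact (T x).le_of_opNorm_le (hB x) _)
  have h6 : η * μ * ‖T y (T x w)‖ ≤ κ' * ‖u‖ := by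
    have h7 : ‖T x u‖ ≤ B * ‖u‖ := (T x).le_of_opNorm_le (hB x) u
    calc η * μ * ‖T y (T x w)‖ ≤ κ' * a / B ^ 3 * μ * (B * (B * ‖w‖)) := by
          gcongr; exact min_le_right _ _
      _ = κ' / B * (a * (μ * ‖w‖)) := by field_simp
      _ ≤ κ' / B * (B * ‖u‖) :=
          mul_le_mul_of_nonneg_left (h1.trans h7) (by positivity)
      _ = κ' * ‖u‖ := by field_simp
  have h7 := C.add_mem (C.add_mem h4 (C.smul_mem (he.mem hC) (sub_nonneg.2 h6)))
    (C.smul_mem (he.smul_sub_mem (T y (T x w))) (show 0 ≤ η * μ by positivity))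
  have h8 : ((1 - η) * μ) • T y (T x w) + T y (T x f)
      = T y (T x u) - (κ' * ‖u‖) • e + (κ' * ‖u‖ - η * μ * ‖T y (T x w)‖) • e
        + (η * μ) • (‖T y (T x w)‖ • e - T y (T x w)) := by
    rw [show T y (T x u) = μ • T y (T x w) + T y (T x f) by simp [hu]]
    module
  rw [h8]
  exact h7

end Contraction

section Iteration

variable {X : Type*} [NormedAddCommGroup X] [NormedSpace ℝ X] {C : ProperCone ℝ X} {e : X}
variable {E : Type*} [TopologicalSpace E] [CompactSpace E] {T : E → X →L[ℝ] X}

lemma IsPositiveFunctional.apply_pos_of_mem_interior {φ : StrongDual ℝ X}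
    (hφ : IsPositiveFunctional C φ) (hφe : 0 < φ e) {u : X} (hu : u ∈ interior (C : Set X)) :
    0 < φ u := by
  obtain ⟨κ, hκ, h⟩ := IsNormOrderUnit.exists_sub_smul_mem_of_isCompact (C := C)
    (isCompact_singleton (x := u)) (by simpa using hu) e
  have := hφ _ (h u rfl)
  simp only [map_sub, map_smul, smul_eq_mul] at this
  have : 0 < κ * φ e := by positivity
  linarith

/-- Exponential decay, relative to the orbit of the order unit, of every vector whose orbit is
annihilated by a positive functional one step later. The order bound is contracted every second
step, and the norm follows it. -/
lemma exists_norm_cocycle_le_of_apply_eq_zero [CompleteSpace X] [Nontrivial X]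
    (hC : IsStronglyOrdered C) (he : IsNormOrderUnit C e) (hT : Continuous T)
    (hTc : ∀ x, IsCompactOperator (T x)) (hTpos : ∀ x, StronglyPositive C (T x)) (F : E → E) :
    ∃ M γ : ℝ, 0 < M ∧ 0 < γ ∧ γ < 1 ∧ ∀ (n : ℕ) (x : E) (φ : StrongDual ℝ X),
      IsPositiveFunctional C φ → 0 < φ e → ∀ f : X, φ (cocycle F T (n + 1) x f) = 0 →
        ‖cocycle F T n x f‖ ≤ M * γ ^ n * ‖f‖ * ‖cocycle F T n x e‖ := by
  have heC := he.mem hC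
  have he0 := he.ne_zero hC
  have hne : 1 ≤ ‖e‖ := he.le_norm_of_sub_smul_mem hC (u := e) (c := 1) (by simp)
  obtain ⟨κ, hκ, hw⟩ := exists_cocycle_sub_smul_mem hC he hT hTc hTpos F
  obtain ⟨L, hL, hnorm⟩ := exists_norm_apply_le hC he hT hTc hTpos hκ
  obtain ⟨θ, hθ, hθ1, hord⟩ := exists_order_contraction hC he hT hTc hTpos hκ hL
  have hcomp : ∀ (φ : StrongDual ℝ X), IsPositiveFunctional C φ → 0 < φ e → ∀ x,
      IsPositiveFunctional C (φ.comp (T x)) ∧ 0 < φ.comp (T x) e := fun φ hφ hφe x =>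
    ⟨hφ.comp fun v hv => (hTpos x).map_mem hv,
      hφ.apply_pos_of_mem_interior hφe (hTpos x e heC he0)⟩
  have heven : ∀ (k : ℕ) (x : E) (φ : StrongDual ℝ X),
      IsPositiveFunctional C φ → 0 < φ e → ∀ f : X, φ (cocycle F T (2 * k + 1) x f) = 0 →
        (θ ^ k * ‖f‖) • cocycle F T (2 * k) x e + cocycle F T (2 * k) x f ∈ C ∧
        (θ ^ k * ‖f‖) • cocycle F T (2 * k) x e - cocycle F T (2 * k) x f ∈ C ∧
        ‖cocycle F T (2 * k) x f‖ ≤ L * (θ ^ k * ‖f‖ * ‖cocycle F T (2 * k) x e‖) := by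
    intro k x
    induction k with
    | zero =>
      intro φ _ _ f _
      refine ⟨by simpa using he f, by simpa using he.smul_sub_mem f, ?_⟩
      simp only [mul_zero, cocycle_zero_apply, pow_zero, one_mul]
      calc ‖f‖ = 1 * (‖f‖ * 1) := by ring
        _ ≤ L * (‖f‖ * ‖e‖) := by gcongr
    | succ k ih =>
      intro φ hφ hφe f hf
      obtain ⟨h1, h1e⟩ := hcomp φ hφ hφe (F^[2 * k + 2] x)
      obtain ⟨h2, h2e⟩ := hcomp _ h1 h1e (F^[2 * k + 1] x)
      obtain ⟨i1, i2, i3⟩ := ih _ h2 h2e f hf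
      have hμ : 0 ≤ θ ^ k * ‖f‖ := by positivity
      have hw0 := hw (2 * k) x
      have hw1 := hw (2 * k + 1) x
      have hf2 : (φ.comp (T (F^[2 * k + 2] x))) (T (F^[2 * k + 1] x)
        (T (F^[2 * k] x) (cocycle F T (2 * k) x f))) = 0 := hf
      have n1 := hnorm (F^[2 * k] x) (F^[2 * k + 1] x) _ h1 h1e _ _ _ hμ hw0 i1 hf2 i3
      have hmem : (θ ^ k * ‖f‖) • cocycle F T (2 * k + 1) x e
          + cocycle F T (2 * k + 1) x f ∈ C := by
        have := (hTpos (F^[2 * k] x)).map_mem i1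
        rwa [map_add, map_smul] at this
      have n2 := hnorm (F^[2 * k + 1] x) (F^[2 * k + 2] x) φ hφ hφe
        (cocycle F T (2 * k + 1) x e) (cocycle F T (2 * k + 1) x f) _ hμ hw1 hmem hf (by
          refine n1.trans ?_
          gcongr
          · linarith
          · exact le_rfl)
      have o1 := hord (F^[2 * k] x) (F^[2 * k + 1] x) _ h2 h2e _ _ _ hμ hw0 hw1 i1 hf2 i3
      have o2 := hord (F^[2 * k] x) (F^[2 * k + 1] x) _ h2 h2e _ (-cocycle F T (2 * k) x f) _ hμ
        hw0 hw1 (by rwa [← sub_eq_add_neg]) (by simpa using hf2) (by rwa [norm_neg])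
      have hpow : θ ^ (k + 1) * ‖f‖ = θ * (θ ^ k * ‖f‖) := by ring
      refine ⟨by rw [hpow]; exact o1, ?_, ?_⟩
      · rw [hpow]
        rw [map_neg, map_neg, ← sub_eq_add_neg] at o2
        exact o2
      · refine n2.trans ?_
        rw [hpow]
        have h0 : 0 ≤ L * (θ ^ k * ‖f‖ * ‖cocycle F T (2 * k + 2) x e‖) := by positivity
        calc L / 2 * (θ ^ k * ‖f‖ * ‖cocycle F T (2 * k + 2) x e‖)
            = 1 / 2 * (L * (θ ^ k * ‖f‖ * ‖cocycle F T (2 * k + 2) x e‖)) := by ring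
          _ ≤ θ * (L * (θ ^ k * ‖f‖ * ‖cocycle F T (2 * k + 2) x e‖)) := by gcongr
          _ = L * (θ * (θ ^ k * ‖f‖) * ‖cocycle F T (2 * k + 2) x e‖) := by ring
  -- two steps contract by `θ`, so the rate per step is the square root of `θ`
  have hθ0 : 0 < θ := by linarith
  have hγ0 : 0 < √θ := Real.sqrt_pos.2 hθ0
  have hγ1 : √θ < 1 := by rw [Real.sqrt_lt' one_pos]; simpa using hθ1
  have hpow : ∀ k : ℕ, √θ ^ (2 * k) = θ ^ k := fun k => by rw [pow_mul, Real.sq_sqrt hθ0.le]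
  refine ⟨L / √θ, √θ, by positivity, hγ0, hγ1, fun n x φ hφ hφe f hf => ?_⟩
  obtain ⟨k, rfl | rfl⟩ := n.even_or_odd'
  · obtain ⟨-, -, h3⟩ := heven k x φ hφ hφe f hf
    refine h3.trans ?_
    rw [hpow]
    have : L ≤ L / √θ := by
      rw [le_div_iff₀ hγ0]
      nlinarith
    calc L * (θ ^ k * ‖f‖ * ‖cocycle F T (2 * k) x e‖)
        ≤ L / √θ * (θ ^ k * ‖f‖ * ‖cocycle F T (2 * k) x e‖) := by gcongr
      _ = _ := by ring
  · obtain ⟨h1, h1e⟩ := hcomp φ hφ hφe (F^[2 * k + 1] x)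
    obtain ⟨i1, -, i3⟩ := heven k x _ h1 h1e f hf
    have n1 : ‖cocycle F T (2 * k + 1) x f‖ ≤ _ :=
      hnorm (F^[2 * k] x) (F^[2 * k + 1] x) φ hφ hφe _ _ _ (by positivity) (hw (2 * k) x) i1 hf i3
    refine n1.trans ?_
    rw [pow_succ, hpow]
    calc L / 2 * (θ ^ k * ‖f‖ * ‖cocycle F T (2 * k + 1) x e‖)
        ≤ L * (θ ^ k * ‖f‖ * ‖cocycle F T (2 * k + 1) x e‖) := by gcongr; linarith
      _ = _ := by field_simp

end Iteration

/-! ### The invariant functionals -/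

section Functional

variable {X : Type*} [NormedAddCommGroup X] [NormedSpace ℝ X] {C : ProperCone ℝ X} {e : X}
variable {E : Type*} [TopologicalSpace E] {F : E → E} {T : E → X →L[ℝ] X}

/-- A continuous field `l` of positive functionals, normalised by `l x e = 1`, that spans a line
field invariant under the adjoint operators: `l (F x) ∘ T x` is a multiple of `l x`, the factor
being read off at `e`. -/
structure IsInvariantFunctional (C : ProperCone ℝ X) (F : E → E) (T : E → X →L[ℝ] X) (e : X)
    (l : E → StrongDual ℝ X) : Prop where
  continuous : Continuous l
  positive : ∀ x, IsPositiveFunctional C (l x)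
  apply_unit : ∀ x, l x e = 1
  apply_map : ∀ x u, l (F x) (T x u) = l (F x) (T x e) * l x u

lemma continuous_cocycle (hF : Continuous F) (hT : Continuous T) (n : ℕ) :
    Continuous (cocycle F T n) := by
  induction n with
  | zero => exact continuous_const
  | succ n ih => exact (hT.comp (hF.iterate n)).clm_comp ih

/-- The invariant functionals are the uniform limits of the normalised pullbacks
`φ ∘ T_x^n / φ (T_x^n e)` of one positive functional `φ`. -/
lemma exists_isInvariantFunctional [CompactSpace E] [CompleteSpace X] [Nontrivial X]
    (hC : IsStronglyOrdered C)
    (he : IsNormOrderUnit C e) (hT : Continuous T) (hTc : ∀ x, IsCompactOperator (T x))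
    (hTpos : ∀ x, StronglyPositive C (T x)) (hF : Continuous F) :
    ∃ l : E → StrongDual ℝ X, IsInvariantFunctional C F T e l ∧
      ∃ M γ : ℝ, 0 < M ∧ 0 < γ ∧ γ < 1 ∧ ∀ (n : ℕ) (x : E) (f : X), l x f = 0 →
        ‖cocycle F T n x f‖ ≤ M * γ ^ n * ‖f‖ * ‖cocycle F T n x e‖ := by
  have heC := he.mem hC
  have he0 := he.ne_zero hC
  obtain ⟨φ, hφ, hφe⟩ := he.exists_positiveFunctional hC
  obtain ⟨κ, hκ, hw⟩ := exists_cocycle_sub_smul_mem hC he hT hTc hTpos F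
  obtain ⟨K, hK, hKw⟩ := exists_norm_le_mul_norm_apply hC he hT hTpos hκ
  obtain ⟨B, hB1, hB⟩ := exists_norm_le_of_continuous hT
  obtain ⟨M, γ, hM, hγ0, hγ1, hdecay⟩ :=
    exists_norm_cocycle_le_of_apply_eq_zero hC he hT hTc hTpos F
  have hwpos : ∀ n x, 0 < ‖cocycle F T n x e‖ := by
    intro n x
    induction n with
    | zero => exact norm_pos_iff.2 he0
    | succ n ih => exact pos_of_mul_pos_right (ih.trans_le (hKw (F^[n] x) _ (hw n x))) hK.le
  have hφn : ∀ n x, 0 < φ (cocycle F T (n + 1) x e) ∧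
      κ * ‖cocycle F T (n + 1) x e‖ ≤ φ (cocycle F T (n + 1) x e) := by
    intro n x
    have h1 := hφ _ (hw (n + 1) x)
    simp only [map_sub, map_smul, smul_eq_mul, hφe] at h1
    have h2 := mul_pos hκ (hwpos (n + 1) x)
    exact ⟨by linarith, by linarith⟩
  set a : ℕ → E → StrongDual ℝ X := fun n x =>
    (φ (cocycle F T (n + 1) x e))⁻¹ • φ.comp (cocycle F T (n + 1) x) with ha
  have haapp : ∀ n x u, a n x u = (φ (cocycle F T (n + 1) x e))⁻¹ * φ (cocycle F T (n + 1) x u) :=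
    fun n x u => rfl
  have hapos : ∀ n x, IsPositiveFunctional C (a n x) := fun n x v hv =>
    mul_nonneg (inv_nonneg.2 (hφn n x).1.le) (hφ _ (cocycle_mem hTpos _ x hv))
  have hae : ∀ n x, a n x e = 1 := fun n x => inv_mul_cancel₀ (hφn n x).1.ne'
  have hacont : ∀ n, Continuous (a n) := fun n => by
    have := continuous_cocycle hF hT (n + 1)
    refine Continuous.smul (Continuous.inv₀ (by fun_prop) fun x => (hφn n x).1.ne') ?_
    exact continuous_const.clm_comp this
  have hsub : ∀ n x u, ‖u - a n x u • e‖ ≤ (1 + ‖e‖) * ‖u‖ := by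
    intro n x u
    have h1 := he.abs_apply_le (hapos n x) u
    rw [hae, mul_one] at h1
    calc ‖u - a n x u • e‖ ≤ ‖u‖ + |a n x u| * ‖e‖ := by
          refine (norm_sub_le _ _).trans_eq ?_
          rw [norm_smul, Real.norm_eq_abs]
      _ ≤ ‖u‖ + ‖u‖ * ‖e‖ := by gcongr
      _ = _ := by ring
  have hker : ∀ n x u, ‖cocycle F T n x (u - a n x u • e)‖
      ≤ M * γ ^ n * ((1 + ‖e‖) * ‖u‖) * ‖cocycle F T n x e‖ := by
    intro n x u
    refine (hdecay n x φ hφ (hφe ▸ one_pos) _ ?_).trans (by gcongr; exact hsub n x u)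
    simp only [map_sub, map_smul, smul_eq_mul, haapp]
    have := (hφn n x).1.ne'
    field_simp
    ring
  set D : ℝ := κ⁻¹ * K ^ 2 * (B ^ 2 * (M * (1 + ‖e‖))) with hD
  have hD0 : 0 < D := by positivity
  have hdist : ∀ x n, dist (a n x) (a (n + 1) x) ≤ D * γ ^ n := by
    intro x n
    rw [dist_comm, dist_eq_norm]
    refine ContinuousLinearMap.opNorm_le_bound _ (by positivity) fun u => ?_
    set f := u - a n x u • e with hf
    have h1 : (a (n + 1) x - a n x) u = a (n + 1) x f := by
      simp [hf, hae]
    have h2 : ‖cocycle F T (n + 2) x f‖ ≤ B * (B * ‖cocycle F T n x f‖) :=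
      ((T _).le_of_opNorm_le (hB _) _).trans (by gcongr; exact (T _).le_of_opNorm_le (hB _) _)
    have h3 : |φ (cocycle F T (n + 2) x f)| ≤ ‖cocycle F T (n + 2) x f‖ := by
      simpa [hφe] using he.abs_apply_le hφ (cocycle F T (n + 2) x f)
    have h4 : ‖cocycle F T n x e‖ ≤ K * (K * ‖cocycle F T (n + 2) x e‖) :=
      (hKw (F^[n] x) _ (hw n x)).trans
        (by gcongr; exact hKw (F^[n + 1] x) _ (hw (n + 1) x))
    obtain ⟨hp, hq⟩ := hφn (n + 1) x
    rw [h1, haapp, Real.norm_eq_abs, abs_mul, abs_inv, abs_of_pos hp, inv_mul_eq_div,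
      div_le_iff₀ hp]
    calc |φ (cocycle F T (n + 2) x f)|
        ≤ B * (B * (M * γ ^ n * ((1 + ‖e‖) * ‖u‖) * ‖cocycle F T n x e‖)) :=
          h3.trans (h2.trans (by gcongr; exact hker n x u))
      _ ≤ B * (B * (M * γ ^ n * ((1 + ‖e‖) * ‖u‖) *
            (K * (K * (κ⁻¹ * φ (cocycle F T (n + 2) x e)))))) := by
          gcongr
          refine h4.trans ?_
          gcongr
          rw [inv_mul_eq_div, le_div_iff₀ hκ]
          linarith
      _ = D * γ ^ n * ‖u‖ * φ (cocycle F T (n + 2) x e) := by rw [hD]; ring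
  have hlim : ∀ x, ∃ b, Tendsto (fun n => a n x) atTop (𝓝 b) := fun x =>
    cauchySeq_tendsto_of_complete (cauchySeq_of_le_geometric γ D hγ1 (hdist x))
  choose l hl using hlim
  have hrate : ∀ x n, dist (a n x) (l x) ≤ D * γ ^ n / (1 - γ) := fun x n =>
    dist_le_of_le_geometric_of_tendsto γ D hγ1 (hdist x) (hl x) n
  have hlapp : ∀ x u, Tendsto (fun n => a n x u) atTop (𝓝 (l x u)) := fun x u =>
    ((ContinuousLinearMap.apply ℝ ℝ u).continuous.tendsto _).comp (hl x)
  have hunif : TendstoUniformly a l atTop := by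
    rw [Metric.tendstoUniformly_iff]
    intro ε hε
    have h0 : Tendsto (fun n => D * γ ^ n / (1 - γ)) atTop (𝓝 0) := by
      have := ((tendsto_pow_atTop_nhds_zero_of_lt_one hγ0.le hγ1).const_mul D).div_const (1 - γ)
      simpa using this
    filter_upwards [h0.eventually_lt_const hε] with n hn x
    rw [dist_comm]
    exact (hrate x n).trans_lt hn
  refine ⟨l, ⟨hunif.continuous (Frequently.of_forall hacont), fun x v hv => ?_, fun x => ?_,
    fun x u => ?_⟩, M * (1 + ‖e‖) + D / (1 - γ), γ, ?_, hγ0, hγ1, fun n x u hu => ?_⟩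
  · exact ge_of_tendsto' (hlapp x v) fun n => hapos n x v hv
  · exact tendsto_nhds_unique (hlapp x e) (by simp [hae])
  · refine tendsto_nhds_unique (hlapp (F x) (T x u)) ?_
    refine Tendsto.congr (fun n => ?_)
      ((hlapp (F x) (T x e)).mul ((hlapp x u).comp (tendsto_add_atTop_nat 1)))
    simp only [Function.comp_apply, haapp, ← cocycle_succ_apply']
    have h1 := (hφn n (F x)).1.ne'
    have h2 := (hφn (n + 1) x).1.ne'
    field_simp
  · have : 0 < 1 - γ := by linarith
    positivity
  · have h1 : |a n x u| ≤ D * γ ^ n / (1 - γ) * ‖u‖ := by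
      have h2 := (a n x - l x).le_opNorm u
      rw [← dist_eq_norm, sub_apply, hu, sub_zero, Real.norm_eq_abs] at h2
      exact h2.trans (by gcongr; exact hrate x n)
    have h2 : cocycle F T n x u
        = cocycle F T n x (u - a n x u • e) + a n x u • cocycle F T n x e := by simp
    rw [h2]
    calc _ ≤ ‖cocycle F T n x (u - a n x u • e)‖ + |a n x u| * ‖cocycle F T n x e‖ := by
          refine (norm_add_le _ _).trans_eq ?_
          rw [norm_smul, Real.norm_eq_abs]
      _ ≤ M * γ ^ n * ((1 + ‖e‖) * ‖u‖) * ‖cocycle F T n x e‖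
          + D * γ ^ n / (1 - γ) * ‖u‖ * ‖cocycle F T n x e‖ := by
          gcongr
          exact hker n x u
      _ = _ := by ring

end Functional

namespace IsInvariantFunctional

variable {X : Type*} [NormedAddCommGroup X] [NormedSpace ℝ X] {C : ProperCone ℝ X} {e : X}
variable {E : Type*} [TopologicalSpace E] {F : E → E} {T : E → X →L[ℝ] X}
variable {l : E → StrongDual ℝ X}

lemma apply_map_pos (hl : IsInvariantFunctional C F T e l)
    (hTpos : ∀ x, StronglyPositive C (T x)) (x y : E) {v : X} (hv : v ∈ C) (h0 : v ≠ 0) :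
    0 < l y (T x v) :=
  (hl.positive y).apply_pos_of_mem_interior (hl.apply_unit y ▸ one_pos) (hTpos x v hv h0)

lemma mem_strictDualCone (hl : IsInvariantFunctional C F T e l)
    (hTpos : ∀ x, StronglyPositive C (T x)) (x : E) : l x ∈ strictDualCone C := by
  intro v hv h0
  have h1 := hl.apply_map_pos hTpos x (F x) hv h0
  rw [hl.apply_map] at h1
  have h2 := (hl.positive x) v hv
  exact lt_of_le_of_ne h2 fun h => by simp [← h] at h1

lemma apply_cocycle (hl : IsInvariantFunctional C F T e l) (n : ℕ) (x : E) (u : X) :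
    l (F^[n] x) (cocycle F T n x u) = l (F^[n] x) (cocycle F T n x e) * l x u := by
  induction n with
  | zero => simp [hl.apply_unit]
  | succ n ih =>
    rw [Function.iterate_succ_apply', cocycle_succ_apply, cocycle_succ_apply, hl.apply_map, ih,
      hl.apply_map _ (cocycle F T n x e)]
    ring

lemma apply_cocycle_unit_pos (hl : IsInvariantFunctional C F T e l)
    (hTpos : ∀ x, StronglyPositive C (T x)) (he : e ∈ C) (h0 : e ≠ 0) (n : ℕ) (x : E) :
    0 < l (F^[n] x) (cocycle F T n x e) := by
  induction n with
  | zero => simp [hl.apply_unit]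
  | succ n ih =>
    rw [Function.iterate_succ_apply', cocycle_succ_apply, hl.apply_map]
    exact mul_pos (hl.apply_map_pos hTpos _ _ he h0) ih

end IsInvariantFunctional

/-! ### The invariant vectors -/

section Vector

variable {X : Type*} [NormedAddCommGroup X] [NormedSpace ℝ X] {C : ProperCone ℝ X} {e : X}
variable {E : Type*} [TopologicalSpace E] {F : E ≃ₜ E} {T : E → X →L[ℝ] X}
variable {l : E → StrongDual ℝ X}

/-- The image of `e` under `T_y^n`, where `y = F^{-n} x`, normalised by `l x` to have value `1`. -/
noncomputable def normalizedImage (F : E ≃ₜ E) (T : E → X →L[ℝ] X) (l : E → StrongDual ℝ X)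
    (e : X) : ℕ → E → X
  | 0, _ => e
  | n + 1, x => (l x (T (F.symm x) e))⁻¹ • T (F.symm x) (normalizedImage F T l e n (F.symm x))

lemma map_normalizedImage (hpos : ∀ x, 0 < l (F x) (T x e)) (n : ℕ) (x : E) :
    T x (normalizedImage F T l e n x)
      = l (F x) (T x e) • normalizedImage F T l e (n + 1) (F x) := by
  rw [normalizedImage, F.symm_apply_apply, smul_smul, mul_inv_cancel₀ (hpos x).ne', one_smul]

lemma apply_normalizedImage (hl : IsInvariantFunctional C F T e l)
    (hpos : ∀ x, 0 < l (F x) (T x e)) (n : ℕ) (x : E) :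
    l x (normalizedImage F T l e n x) = 1 := by
  induction n generalizing x with
  | zero => exact hl.apply_unit x
  | succ n ih =>
    obtain ⟨y, rfl⟩ := F.surjective x
    rw [normalizedImage, F.symm_apply_apply, map_smul,
      hl.apply_map y (normalizedImage F T l e n y), ih, mul_one, smul_eq_mul,
      inv_mul_cancel₀ (hpos y).ne']

lemma normalizedImage_mem (hTpos : ∀ x, StronglyPositive C (T x))
    (he : e ∈ C) (hpos : ∀ x, 0 < l (F x) (T x e)) (n : ℕ) (x : E) :
    normalizedImage F T l e n x ∈ C := by
  induction n generalizing x with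
  | zero => exact he
  | succ n ih =>
    obtain ⟨y, rfl⟩ := F.surjective x
    rw [normalizedImage, F.symm_apply_apply]
    exact C.smul_mem ((hTpos y).map_mem (ih y)) (inv_nonneg.2 (hpos y).le)

lemma continuous_normalizedImage (hT : Continuous T) (hl : Continuous l)
    (hpos : ∀ x, 0 < l (F x) (T x e)) (n : ℕ) : Continuous (normalizedImage F T l e n) := by
  induction n with
  | zero => exact continuous_const
  | succ n ih =>
    have hF := F.symm.continuous
    refine Continuous.smul (Continuous.inv₀ ?_ fun x => ?_) ?_
    · exact hl.clm_apply ((hT.comp hF).clm_apply continuous_const)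
    · have := hpos (F.symm x)
      rw [F.apply_symm_apply] at this
      exact this.ne'
    · exact (hT.comp hF).clm_apply (ih.comp hF)

lemma smul_normalizedImage_sub (hl : IsInvariantFunctional C F T e l)
    (hpos : ∀ x, 0 < l (F x) (T x e)) (n : ℕ) (x : E) :
    l (F^[n] x) (cocycle F T n x e) •
        (normalizedImage F T l e (n + 1) (F^[n] x) - normalizedImage F T l e n (F^[n] x))
      = cocycle F T n x (normalizedImage F T l e 1 x - normalizedImage F T l e 0 x) := by
  induction n with
  | zero => simp [hl.apply_unit]
  | succ n ih =>
    rw [cocycle_succ_apply n x (_ - _), ← ih, Function.iterate_succ_apply', cocycle_succ_apply,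
      hl.apply_map _ (cocycle F T n x e), map_smul, map_sub, map_normalizedImage hpos,
      map_normalizedImage hpos, ← smul_sub, smul_smul, mul_comm]

/-- The invariant vectors are the uniform limits of the normalised images of `e`: the difference
of two consecutive ones is the image of a vector in the kernel of the invariant functional. -/
lemma exists_invariant_vector [CompactSpace E] [CompleteSpace X] [Nontrivial X]
    (hC : IsStronglyOrdered C) (he : IsNormOrderUnit C e) (hT : Continuous T)
    (hTpos : ∀ x, StronglyPositive C (T x)) (hl : IsInvariantFunctional C F T e l)
    {κ : ℝ} (hκ : 0 < κ) (hw : ∀ n x, 0 < l (F^[n] x) (cocycle F T n x e) ∧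
      κ * ‖cocycle F T n x e‖ ≤ l (F^[n] x) (cocycle F T n x e))
    {M γ : ℝ} (hM : 0 < M) (hγ0 : 0 < γ) (hγ1 : γ < 1)
    (hdecay : ∀ (n : ℕ) (x : E) (f : X), l x f = 0 →
        ‖cocycle F T n x f‖ ≤ M * γ ^ n * ‖f‖ * ‖cocycle F T n x e‖) :
    ∃ v : E → X, Continuous v ∧ (∀ x, v x ∈ interior (C : Set X)) ∧ (∀ x, l x (v x) = 1) ∧
      ∀ x, T x (v x) = l (F x) (T x e) • v (F x) := by
  have hpos : ∀ x, 0 < l (F x) (T x e) := fun x => (hw 1 x).1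
  set p := normalizedImage F T l e with hp
  have hpc : ∀ n, Continuous (p n) := continuous_normalizedImage hT hl.continuous hpos
  obtain ⟨b, hb⟩ := isCompact_univ.exists_bound_of_continuousOn
    ((hpc 1).sub (hpc 0)).continuousOn
  have hb0 : 0 ≤ max b 0 := le_max_right _ _
  have hdist : ∀ x n, dist (p n x) (p (n + 1) x) ≤ M * max b 0 / κ * γ ^ n := by
    intro x n
    obtain ⟨y, rfl⟩ := (F.surjective.iterate n) x
    obtain ⟨h1, h2⟩ := hw n y
    have h3 := congrArg norm (smul_normalizedImage_sub hl hpos n y)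
    rw [norm_smul, Real.norm_of_nonneg h1.le] at h3
    have h4 := hdecay n y (p 1 y - p 0 y) (by
      rw [map_sub, apply_normalizedImage hl hpos, apply_normalizedImage hl hpos, sub_self])
    rw [dist_comm, dist_eq_norm]
    refine le_of_mul_le_mul_left (h3.trans_le (h4.trans ?_)) h1
    calc M * γ ^ n * ‖p 1 y - p 0 y‖ * ‖cocycle F T n y e‖
        ≤ M * γ ^ n * max b 0 * (l (F^[n] y) (cocycle F T n y e) / κ) := by
          gcongr
          · exact (hb y (mem_univ y)).trans (le_max_left _ _)
          · rw [le_div_iff₀ hκ]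
            linarith
      _ = _ := by field_simp
  choose v hv using fun x =>
    cauchySeq_tendsto_of_complete (cauchySeq_of_le_geometric γ _ hγ1 (hdist x))
  have hunif : TendstoUniformly p v atTop := by
    rw [Metric.tendstoUniformly_iff]
    intro ε hε
    have h0 : Tendsto (fun n => M * max b 0 / κ * γ ^ n / (1 - γ)) atTop (𝓝 0) := by
      have := ((tendsto_pow_atTop_nhds_zero_of_lt_one hγ0.le hγ1).const_mul
        (M * max b 0 / κ)).div_const (1 - γ)
      simpa using this
    filter_upwards [h0.eventually_lt_const hε] with n hn x
    rw [dist_comm]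
    exact (dist_le_of_le_geometric_of_tendsto γ _ hγ1 (hdist x) (hv x) n).trans_lt hn
  have hv1 : ∀ x, l x (v x) = 1 := fun x =>
    tendsto_nhds_unique (((l x).continuous.tendsto _).comp (hv x))
      (tendsto_const_nhds.congr fun n => (apply_normalizedImage hl hpos n x).symm)
  have hvC : ∀ x, v x ∈ C := fun x =>
    C.isClosed.mem_of_tendsto (hv x)
      (Eventually.of_forall fun n => normalizedImage_mem hTpos (he.mem hC) hpos n x)
  have hvT : ∀ x, T x (v x) = l (F x) (T x e) • v (F x) := fun x =>
    tendsto_nhds_unique (((T x).continuous.tendsto _).comp (hv x))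
      ((((hv (F x)).comp (tendsto_add_atTop_nat 1)).const_smul _).congr fun n =>
        (map_normalizedImage hpos n x).symm)
  refine ⟨v, hunif.continuous (Frequently.of_forall hpc), fun x => ?_, hv1, hvT⟩
  obtain ⟨y, rfl⟩ := F.surjective x
  have hvy : v y ≠ 0 := fun h => by simpa [h] using hv1 y
  have h1 : v (F y) = T y ((l (F y) (T y e))⁻¹ • v y) := by
    rw [map_smul, hvT, smul_smul, inv_mul_cancel₀ (hpos y).ne', one_smul]
  rw [h1]
  exact hTpos y _ (C.smul_mem (hvC y) (inv_nonneg.2 (hpos y).le))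
    (smul_ne_zero (inv_ne_zero (hpos y).ne') hvy)

end Vector

/-! ### Consequences of an invariant unit section -/

section Consequences

variable {X : Type*} [NormedAddCommGroup X] [NormedSpace ℝ X] {C : ProperCone ℝ X} {e : X}

lemma isContinuousLineBundle_span {E : Type*} [TopologicalSpace E] {s : E → X} (hs : Continuous s)
    (h0 : ∀ x, s x ≠ 0) : IsContinuousLineBundle fun x => Submodule.span ℝ {s x} :=
  fun _ => ⟨univ, univ_mem, s, hs.continuousOn, fun x _ => ⟨h0 x, rfl⟩⟩

lemma map_span_singleton_eq {Y : Type*} [AddCommGroup Y] [Module ℝ Y] {L : Y →ₗ[ℝ] Y} {s t : Y}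
    {c : ℝ} (hc : c ≠ 0) (h : L s = c • t) :
    (Submodule.span ℝ {s}).map L = Submodule.span ℝ {t} := by
  rw [Submodule.map_span, image_singleton, h, Submodule.span_singleton_smul_eq (IsUnit.mk0 c hc)]

/-- Growth along an invariant unit section is a product of values of a positive continuous
function, so uniform continuity of that function controls it along nearby orbits. -/
lemma exists_growth_control {E : Type*} [MetricSpace E] [CompactSpace E] {F : E → E}
    {T : E → X →L[ℝ] X} (hT : Continuous T) {v : E → X} (hv : Continuous v)
    (hv1 : ∀ x, ‖v x‖ = 1) {g : E → ℝ} (hg : ∀ x, 0 < g x) (hTv : ∀ x, T x (v x) = g x • v (F x))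
    {ε : ℝ} (hε : 0 < ε) :
    ∃ δ > (0 : ℝ), ∀ (x y : E) (m : ℕ), (∀ i ≤ m, dist (F^[i] x) (F^[i] y) < δ) →
      ‖cocycle F T m y (v y)‖ ≤ (1 + ε) ^ m * ‖cocycle F T m x (v x)‖ := by
  have hgn : ∀ x, g x = ‖T x (v x)‖ := fun x => by
    rw [hTv, norm_smul, hv1, mul_one, Real.norm_of_nonneg (hg x).le]
  have hgc : Continuous g := by
    rw [funext hgn]
    fun_prop
  have hcoc : ∀ (n : ℕ) (x : E), ∃ c : ℝ, 0 < c ∧ cocycle F T n x (v x) = c • v (F^[n] x) := by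
    intro n x
    induction n with
    | zero => exact ⟨1, one_pos, by simp⟩
    | succ n ih =>
      obtain ⟨c, hc, h⟩ := ih
      refine ⟨c * g (F^[n] x), mul_pos hc (hg _), ?_⟩
      rw [cocycle_succ_apply, h, map_smul, hTv, smul_smul, Function.iterate_succ_apply']
  have hnorm : ∀ (n : ℕ) (x : E),
      ‖cocycle F T (n + 1) x (v x)‖ = g (F^[n] x) * ‖cocycle F T n x (v x)‖ := by
    intro n x
    obtain ⟨c, hc, h⟩ := hcoc n x
    rw [cocycle_succ_apply, h, map_smul, norm_smul, norm_smul, ← hgn, hv1]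
    ring
  have hratio : Continuous fun p : E × E => g p.2 / g p.1 :=
    (hgc.comp continuous_snd).div (hgc.comp continuous_fst) fun p => (hg p.1).ne'
  obtain ⟨δ, hδ, hunif⟩ := Metric.uniformContinuous_iff.1
    (CompactSpace.uniformContinuous_of_continuous hratio) ε hε
  refine ⟨δ, hδ, fun x y m hm => ?_⟩
  induction m with
  | zero => simp [hv1]
  | succ m ih =>
    rw [hnorm, hnorm]
    have h1 : g (F^[m] y) ≤ (1 + ε) * g (F^[m] x) := by
      have h2 : dist (F^[m] x, F^[m] y) (F^[m] x, F^[m] x) < δ := by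
        rw [Prod.dist_eq, dist_self, max_lt_iff, dist_comm]
        exact ⟨hδ, hm m (Nat.le_succ m)⟩
      have h3 := hunif h2
      rw [Real.dist_eq, div_self (hg _).ne'] at h3
      rw [← div_le_iff₀ (hg _)]
      linarith [(abs_lt.1 h3).2]
    calc g (F^[m] y) * ‖cocycle F T m y (v y)‖
        ≤ (1 + ε) * g (F^[m] x) * ((1 + ε) ^ m * ‖cocycle F T m x (v x)‖) := by
          gcongr
          · exact mul_nonneg (by linarith) (hg _).le
          · exact ih fun i hi => hm i (hi.trans (Nat.le_succ m))
      _ = _ := by ring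

end Consequences

end ExpSep

/-! ### Exponential separation -/

theorem mainTheorem5 {X : Type*} [NormedAddCommGroup X] [NormedSpace ℝ X] [CompleteSpace X]
    [Nontrivial X] (C : ProperCone ℝ X) (hC : ExpSep.IsStronglyOrdered C)
    {E : Type*} [MetricSpace E] [CompactSpace E] (F : E ≃ₜ E)
    (T : E → X →L[ℝ] X) (hTcont : Continuous T)
    (hTcomp : ∀ x, IsCompactOperator (T x))
    (hTpos : ∀ x, ExpSep.StronglyPositive C (T x)) :
    ∃ (X₁ : E → Submodule ℝ X) (X₁' : E → Submodule ℝ (StrongDual ℝ X))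
      (v : E → X) (l : E → StrongDual ℝ X),
      -- continuous one-dimensional bundles
      ExpSep.IsContinuousLineBundle X₁ ∧ ExpSep.IsContinuousLineBundle X₁' ∧
      -- spanning unit vectors and functionals
      ((∀ x, X₁ x = Submodule.span ℝ {v x}) ∧ (∀ x, X₁' x = Submodule.span ℝ {l x}) ∧
        (∀ x, ‖v x‖ = 1) ∧ (∀ x, ‖l x‖ = 1) ∧
        (∀ x, v x ∈ interior (C : Set X)) ∧ (∀ x, l x ∈ ExpSep.strictDualCone C) ∧
        Continuous v ∧ Continuous l) ∧
      -- invariance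
      (∀ x, (X₁ x).map (T x : X →ₗ[ℝ] X) = X₁ (F x) ∧
        (X₁' (F x)).map
          (ExpSep.adjointOp (T x) : StrongDual ℝ X →ₗ[ℝ] StrongDual ℝ X) = X₁' x) ∧
      -- exponential separation
      (∃ M γ : ℝ, 0 < M ∧ 0 < γ ∧ γ < 1 ∧
        ∀ (x : E) (n : ℕ) (w : X), 1 ≤ n → l x w = 0 → ‖w‖ = 1 →
          ‖ExpSep.cocycle F T n x w‖ ≤ M * γ ^ n * ‖ExpSep.cocycle F T n x (v x)‖) ∧
      -- eventual positivity
      (∀ (x : E) (u : X), 0 < l x u →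
        ∀ᶠ n : ℕ in atTop, ExpSep.cocycle F T n x u ∈ interior (C : Set X)) ∧
      -- internal growth control along the principal bundles
      (∀ ε : ℝ, 0 < ε → ∃ δ₁ : ℝ, 0 < δ₁ ∧ ∀ δ ∈ Icc (0 : ℝ) δ₁, ∀ (x y : E) (m : ℕ), 1 ≤ m →
        (∀ i : ℕ, i ≤ m → dist (F^[i] x) (F^[i] y) < δ) →
        ∀ i : ℕ, 1 ≤ i → i ≤ m →
          ‖ExpSep.cocycle F T i y (v y)‖ ≤
            (1 + ε) ^ i * ‖ExpSep.cocycle F T i x (v x)‖) := by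
  obtain ⟨e, he⟩ := hC.exists_isNormOrderUnit
  have heC := he.mem hC
  have he0 := he.ne_zero hC
  obtain ⟨l, hl, M, γ, hM, hγ0, hγ1, hdecay⟩ :=
    ExpSep.exists_isInvariantFunctional hC he hTcont hTcomp hTpos F.continuous
  obtain ⟨κ, hκ, hgood⟩ := ExpSep.exists_cocycle_sub_smul_mem hC he hTcont hTcomp hTpos F
  set q : ℕ → E → ℝ := fun n x => l (F^[n] x) (ExpSep.cocycle F T n x e) with hq
  have hw : ∀ n x, 0 < q n x ∧ κ * ‖ExpSep.cocycle F T n x e‖ ≤ q n x := by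
    intro n x
    have h1 := hl.positive (F^[n] x) _ (hgood n x)
    simp only [map_sub, map_smul, smul_eq_mul, hl.apply_unit] at h1
    exact ⟨hl.apply_cocycle_unit_pos hTpos heC he0 n x, by simp only [hq]; linarith⟩
  obtain ⟨v, hvc, hvi, hlv, hTv⟩ :=
    ExpSep.exists_invariant_vector hC he hTcont hTpos hl hκ hw hM hγ0 hγ1 hdecay
  have hc : ∀ x, 0 < l (F x) (T x e) := fun x => (hw 1 x).1
  have hv0 : ∀ x, 0 < ‖v x‖ := fun x => norm_pos_iff.2 fun h => by simpa [h] using hlv x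
  have hl0 : ∀ x, 0 < ‖l x‖ := fun x => norm_pos_iff.2 fun h => by simpa [h] using hl.apply_unit x
  -- the unit sections
  set v' : E → X := fun x => ‖v x‖⁻¹ • v x with hv'
  set l' : E → StrongDual ℝ X := fun x => ‖l x‖⁻¹ • l x with hl'
  have hv'n : ∀ x, ‖v' x‖ = 1 := fun x => by
    rw [hv', norm_smul, norm_inv, norm_norm, inv_mul_cancel₀ (hv0 x).ne']
  have hl'n : ∀ x, ‖l' x‖ = 1 := fun x => by
    rw [hl', norm_smul, norm_inv, norm_norm, inv_mul_cancel₀ (hl0 x).ne']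
  have hv'c : Continuous v' := (hvc.norm.inv₀ fun x => (hv0 x).ne').smul hvc
  have hl'c : Continuous l' := (hl.continuous.norm.inv₀ fun x => (hl0 x).ne').smul hl.continuous
  obtain ⟨κv, hκv, hvlow⟩ := ExpSep.IsNormOrderUnit.exists_sub_smul_mem_of_isCompact (C := C)
    (isCompact_range hvc) (range_subset_iff.2 hvi) e
  have hv'T : ∀ x, T x (v' x)
      = (‖v x‖⁻¹ * l (F x) (T x e) * ‖v (F x)‖) • v' (F x) := fun x => by
    simp only [hv', map_smul, hTv, smul_smul]
    rw [mul_assoc, mul_inv_cancel₀ (hv0 _).ne', mul_one]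
  have hg : ∀ x, 0 < ‖v x‖⁻¹ * l (F x) (T x e) * ‖v (F x)‖ := fun x =>
    mul_pos (mul_pos (inv_pos.2 (hv0 x)) (hc x)) (hv0 _)
  have hl'T : ∀ x, ExpSep.adjointOp (T x) (l' (F x))
      = (‖l (F x)‖⁻¹ * l (F x) (T x e) * ‖l x‖) • l' x := fun x => by
    ext u
    simp only [ExpSep.adjointOp, hl', ContinuousLinearMap.precomp_apply,
      ContinuousLinearMap.comp_apply, smul_apply, smul_eq_mul]
    rw [hl.apply_map x u]
    have := (hl0 x).ne'
    field_simp
  have hker : ∀ x u, l' x u = ‖l x‖⁻¹ * l x u := fun x u => rfl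
  have hvcoc : ∀ n x, ExpSep.cocycle F T n x (v x) = q n x • v (F^[n] x) := by
    intro n x
    induction n with
    | zero => simp [hq, hl.apply_unit]
    | succ n ih =>
      rw [ExpSep.cocycle_succ_apply, ih, map_smul, hTv, smul_smul, hq]
      simp only [Function.iterate_succ_apply', ExpSep.cocycle_succ_apply]
      rw [hl.apply_map _ (ExpSep.cocycle F T n x e), mul_comm]
  refine ⟨fun x => Submodule.span ℝ {v' x}, fun x => Submodule.span ℝ {l' x}, v', l',
    ExpSep.isContinuousLineBundle_span hv'c fun x h => by simpa [h] using hv'n x,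
    ExpSep.isContinuousLineBundle_span hl'c fun x h => by simpa [h] using hl'n x,
    ⟨fun _ => rfl, fun _ => rfl, hv'n, hl'n, fun x => ?_, fun x w hwC hw0 => ?_, hv'c, hl'c⟩,
    fun x => ⟨ExpSep.map_span_singleton_eq (hg x).ne' (hv'T x),
      ExpSep.map_span_singleton_eq
        (mul_pos (mul_pos (inv_pos.2 (hl0 (F x))) (hc x)) (hl0 x)).ne' (hl'T x)⟩, ?_, ?_, ?_⟩
  · refine he.mem_interior hC (mul_pos (inv_pos.2 (hv0 x)) hκv) ?_
    have := C.smul_mem (hvlow _ (mem_range_self x)) (inv_nonneg.2 (hv0 x).le)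
    rwa [smul_sub, smul_smul] at this
  · exact mul_pos (inv_pos.2 (hl0 x)) (hl.mem_strictDualCone hTpos x w hwC hw0)
  · -- `‖T_x^n e‖` is controlled by `l (T_x^n e) = l (T_x^n (v x))`
    obtain ⟨b, hb1, hb⟩ : ∃ b : ℝ, 1 ≤ b ∧ ∀ x, ‖v x‖ ≤ b := by
      obtain ⟨b, hb⟩ := isCompact_univ.exists_bound_of_continuousOn hvc.continuousOn
      exact ⟨max b 1, le_max_right _ _, fun x => (hb x (mem_univ x)).trans (le_max_left _ _)⟩
    refine ⟨M * (b / κ), γ, by positivity, hγ0, hγ1, fun x n w _ hlw hw1 => ?_⟩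
    have h1 : l x w = 0 := (mul_eq_zero.1 hlw).resolve_left (inv_ne_zero (hl0 x).ne')
    have h2 := hdecay n x w h1
    have h3 : κ * ‖ExpSep.cocycle F T n x e‖ ≤ b * ‖ExpSep.cocycle F T n x (v' x)‖ := by
      have h4 := he.apply_le (hl.positive (F^[n] x)) (ExpSep.cocycle F T n x (v x))
      rw [hl.apply_cocycle, hlv, mul_one, hl.apply_unit, mul_one] at h4
      have h5 : ‖ExpSep.cocycle F T n x (v x)‖ = ‖v x‖ * ‖ExpSep.cocycle F T n x (v' x)‖ := by
        simp only [hv', map_smul, norm_smul, norm_inv, norm_norm]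
        rw [mul_inv_cancel_left₀ (hv0 x).ne']
      refine (hw n x).2.trans (h4.trans ?_)
      rw [h5]
      gcongr
      exact hb x
    rw [hw1, mul_one] at h2
    refine h2.trans ?_
    calc M * γ ^ n * ‖ExpSep.cocycle F T n x e‖
        ≤ M * γ ^ n * (b * ‖ExpSep.cocycle F T n x (v' x)‖ / κ) := by
          gcongr
          rw [le_div_iff₀ hκ]
          linarith
      _ = _ := by ring
  · intro x u hu
    have ha : 0 < l x u := (pos_iff_pos_of_mul_pos hu).1 (inv_pos.2 (hl0 x))
    set f := u - l x u • v x with hf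
    have hlf : l x f = 0 := by simp [hf, hlv]
    have h0 : Tendsto (fun n : ℕ => l x u * κv - M * γ ^ n * ‖f‖ / κ) atTop
        (𝓝 (l x u * κv)) := by
      have := ((((tendsto_pow_atTop_nhds_zero_of_lt_one hγ0.le hγ1).const_mul M).mul_const
        ‖f‖).div_const κ).const_sub (l x u * κv)
      simpa using this
    filter_upwards [h0.eventually_const_lt (mul_pos ha hκv)] with n hn
    obtain ⟨hq0, hqe⟩ := hw n x
    refine he.mem_interior hC (mul_pos hq0 hn) ?_
    have h1 : ‖ExpSep.cocycle F T n x f‖ ≤ q n x * (M * γ ^ n * ‖f‖ / κ) := by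
      refine (hdecay n x f hlf).trans ?_
      calc M * γ ^ n * ‖f‖ * ‖ExpSep.cocycle F T n x e‖
          ≤ M * γ ^ n * ‖f‖ * (q n x / κ) := by
            gcongr
            rw [le_div_iff₀ hκ]
            linarith
        _ = _ := by ring
    have h2 : ExpSep.cocycle F T n x u
        = (l x u * q n x) • v (F^[n] x) + ExpSep.cocycle F T n x f := by
      rw [hf, map_sub, map_smul, hvcoc, smul_smul]
      abel
    have h3 := C.add_mem (C.add_mem (C.smul_mem (hvlow _ (mem_range_self (F^[n] x)))
      (mul_pos ha hq0).le) (he (ExpSep.cocycle F T n x f)))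
      (C.smul_mem heC (sub_nonneg.2 h1))
    have h4 : ExpSep.cocycle F T n x u - (q n x * (l x u * κv - M * γ ^ n * ‖f‖ / κ)) • e
        = (l x u * q n x) • (v (F^[n] x) - κv • e)
          + (‖ExpSep.cocycle F T n x f‖ • e + ExpSep.cocycle F T n x f)
          + (q n x * (M * γ ^ n * ‖f‖ / κ) - ‖ExpSep.cocycle F T n x f‖) • e := by
      rw [h2]
      module
    rw [h4]
    exact h3
  · intro ε hε
    obtain ⟨δ₁, hδ₁, h⟩ := ExpSep.exists_growth_control hTcont hv'c hv'n hg hv'T hε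
    exact ⟨δ₁, hδ₁, fun δ hδ x y m _ hm i _ him =>
      h x y i fun j hj => (hm j (hj.trans him)).trans_le hδ.2⟩
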